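/- Let $K$ be a global field, i.e. a finite extension of $\mathbb{Q}$ or of $\mathbb{F}(T)$ for some finite field $\mathbb{F}$. For a normalized discrete valuation $v$ of $K$ (so $v(K^*)=\mathbb{Z}$) and a nonzero polynomial $h(x)=\sum_{i} a_i x^i\in K[x]$, the $v$-adic Newton polygon $NP_v(h)$ is the lower boundary of the convex hull of the points $(i,v(a_i))$ with $a_i\neq 0$. The Newton index $\mathscr{N}_h$ of $h$ is the least common multiple of the denominators, in lowest terms, of all slopes of $NP_v(h)$, as $v$ ranges over all normalized discrete valuations of $K$ (the slope $0$ has denominator $1$, and the least common multiple of the empty set is $1$). Let $f(x)\in K[x]$ be a separable irreducible polynomial of degree $n$, let $\mu\in K$, and let $g(x)=f(x-\mu)$. Then $\mathscr{N}_g$ divides the order of the Galois group of $f$ over $K$. Moreover, if $\mathscr{N}_g$ has a prime divisor $q$ in the range $n/2<q<n-2$, then the Galois group of $f$ over $K$, regarded as a group of permutations of the $n$ roots of $f$ in a splitting field, contains the alternating group $A_n$ of all even permutations of the roots. -/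

import Mathlib

open Polynomial WithZero

/-- A global field: a finite extension of `ℚ`, or a finite extension of the field `F(T)` of rational
functions over a finite field `F`. -/
def IsGlobalField (K : Type*) [Field K] : Prop :=
  NumberField K ∨
    ∃ (F : Type) (_ : Field F) (_ : Finite F) (_ : Algebra (RatFunc F) K),
      FunctionField F K

/-- A normalized discrete valuation of a field. Valuations are written multiplicatively here, with
values in `ℤᵐ⁰`; the valuation is normalized when every element of `ℤᵐ⁰` is a value. -/
def IsNormalizedDiscrete {K : Type*} [Field K] (v : Valuation K ℤᵐ⁰) : Prop :=
  Function.Surjective v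

/-- The additive form of a valuation with values in `ℤᵐ⁰`: the integer `ord a` with
`v a = exp (- ord a)`, for `a ≠ 0`. (It is used for nonzero `a` only.) -/
def addOrd {K : Type*} [Field K] (v : Valuation K ℤᵐ⁰) (a : K) : ℤ :=
  -log (v a)

/-- The points `(i, ord aᵢ)`, for the nonzero coefficients `aᵢ` of `f = ∑ aᵢ xⁱ` (a zero coefficient
has infinite valuation and gives no point). -/
def newtonPoints {K : Type*} [Field K] (v : Valuation K ℤᵐ⁰) (f : K[X]) : Set (ℚ × ℚ) :=
  {P | ∃ i ∈ f.support, P = ((i : ℚ), (addOrd v (f.coeff i) : ℚ))}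

/-- The Newton polygon of `f` at `v`: the lower boundary of the convex hull of the points
`(i, ord aᵢ)`. As the vertices have integer coordinates, the rational points carry all the
information, and the polygon is taken in `ℚ × ℚ`. -/
def newtonPolygon {K : Type*} [Field K] (v : Valuation K ℤᵐ⁰) (f : K[X]) : Set (ℚ × ℚ) :=
  {P | P ∈ convexHull ℚ (newtonPoints v f) ∧
    ∀ y : ℚ, (P.1, y) ∈ convexHull ℚ (newtonPoints v f) → P.2 ≤ y}

/-- `s` is a slope of the Newton polygon: the slope of some line segment, not reduced to a point,
that lies on the polygon. -/
def IsNewtonSlope {K : Type*} [Field K] (v : Valuation K ℤᵐ⁰) (f : K[X]) (s : ℚ) : Prop :=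
  ∃ P Q : ℚ × ℚ, P.1 < Q.1 ∧ segment ℚ P Q ⊆ newtonPolygon v f ∧
    s = (Q.2 - P.2) / (Q.1 - P.1)

/-- The denominators, in lowest terms, of all slopes of the Newton polygons of `f` at all normalized
discrete valuations of `K`. -/
def newtonDenominators {K : Type*} [Field K] (f : K[X]) : Set ℕ :=
  {d | ∃ v : Valuation K ℤᵐ⁰, IsNormalizedDiscrete v ∧ ∃ s : ℚ, IsNewtonSlope v f s ∧ d = s.den}

/-- A segment of the Newton polygon spans a line that lies on or below all the points. -/
theorem le_of_segment_subset_newtonPolygon {K : Type*} [Field K] {v : Valuation K ℤᵐ⁰} {f : K[X]}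
    {P Q : ℚ × ℚ} (h : P.1 < Q.1) (hPQ : segment ℚ P Q ⊆ newtonPolygon v f)
    {R : ℚ × ℚ} (hR : R ∈ convexHull ℚ (newtonPoints v f)) :
    P.2 + (Q.2 - P.2) / (Q.1 - P.1) * (R.1 - P.1) ≤ R.2 := by
  have hd : 0 < Q.1 - P.1 := sub_pos.2 h
  have hP := hPQ (left_mem_segment ℚ P Q)
  have hQ := hPQ (right_mem_segment ℚ P Q)
  have hc := convex_convexHull ℚ (newtonPoints v f)
  set s := (Q.2 - P.2) / (Q.1 - P.1) with hs
  have hs' : Q.2 = P.2 + s * (Q.1 - P.1) := by rw [hs]; field_simp; ring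
  rcases le_total R.1 P.1 with h1 | h1
  · -- `P` is on or below the segment from `R` to `Q`
    have hRQ : 0 < Q.1 - R.1 := by linarith
    have := hP.2 ((Q.1 - P.1) / (Q.1 - R.1) * R.2 + (P.1 - R.1) / (Q.1 - R.1) * Q.2) (by
      have := hc hR hQ.1 (a := (Q.1 - P.1) / (Q.1 - R.1)) (b := (P.1 - R.1) / (Q.1 - R.1))
        (by positivity) (div_nonneg (by linarith) hRQ.le) (by field_simp; ring)
      convert this using 1
      ext
      · simp; field_simp; ring
      · simp)
    have h2 : P.2 * (Q.1 - R.1) ≤ (Q.1 - P.1) * R.2 + (P.1 - R.1) * Q.2 := by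
      have := mul_le_mul_of_nonneg_right this hRQ.le
      refine this.trans (le_of_eq ?_)
      field_simp
    rw [hs'] at h2
    refine le_of_mul_le_mul_left ?_ hd
    linarith
  rcases le_total Q.1 R.1 with h3 | h3
  · have hRP : 0 < R.1 - P.1 := by linarith
    have := hQ.2 ((R.1 - Q.1) / (R.1 - P.1) * P.2 + (Q.1 - P.1) / (R.1 - P.1) * R.2) (by
      have := hc hP.1 hR (a := (R.1 - Q.1) / (R.1 - P.1)) (b := (Q.1 - P.1) / (R.1 - P.1))
        (div_nonneg (by linarith) hRP.le) (by positivity) (by field_simp; ring)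
      convert this using 1
      ext
      · simp; field_simp; ring
      · simp)
    have h2 : Q.2 * (R.1 - P.1) ≤ (R.1 - Q.1) * P.2 + (Q.1 - P.1) * R.2 := by
      have := mul_le_mul_of_nonneg_right this hRP.le
      refine this.trans (le_of_eq ?_)
      field_simp
    rw [hs'] at h2
    refine le_of_mul_le_mul_left ?_ hd
    linarith
  · have hm : ((R.1, P.2 + s * (R.1 - P.1)) : ℚ × ℚ) ∈ segment ℚ P Q := by
      refine ⟨(Q.1 - R.1) / (Q.1 - P.1), (R.1 - P.1) / (Q.1 - P.1),
        div_nonneg (by linarith) hd.le, div_nonneg (by linarith) hd.le, by field_simp; ring, ?_⟩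
      ext
      · simp; field_simp; ring
      · simp only [Prod.snd_add, Prod.smul_snd, smul_eq_mul]
        rw [hs']; field_simp; ring
    exact (hPQ hm).2 R.2 hR

/-- A slope of the Newton polygon is the slope of a line through two of the points. -/
theorem IsNewtonSlope.exists_points {K : Type*} [Field K] {v : Valuation K ℤᵐ⁰} {f : K[X]} {s : ℚ}
    (h : IsNewtonSlope v f s) :
    ∃ i ∈ f.support, ∃ j ∈ f.support, i < j ∧
      ((addOrd v (f.coeff j) : ℚ) - addOrd v (f.coeff i)) = s * ((j : ℚ) - i) := by
  obtain ⟨P, Q, hlt, hPQ, rfl⟩ := h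
  have key := fun R hR ↦ le_of_segment_subset_newtonPolygon hlt hPQ (R := R) hR
  have hP := (hPQ (left_mem_segment ℚ P Q)).1
  have hQ := (hPQ (right_mem_segment ℚ P Q)).1
  have hd : Q.1 - P.1 ≠ 0 := (sub_pos.2 hlt).ne'
  set s := (Q.2 - P.2) / (Q.1 - P.1) with hs
  have hs' : Q.2 = P.2 + s * (Q.1 - P.1) := by rw [hs]; field_simp; ring
  clear_value s
  -- points of the hull on the line are combinations of given points on the line
  set T : Set (ℚ × ℚ) := {R ∈ newtonPoints v f | R.2 = P.2 + s * (R.1 - P.1)} with hT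
  have hface : ∀ R ∈ convexHull ℚ (newtonPoints v f), P.2 + s * (R.1 - P.1) < R.2 ∨
      R ∈ convexHull ℚ T := by
    intro R hR
    have hconv : Convex ℚ {R : ℚ × ℚ | P.2 + s * (R.1 - P.1) ≤ R.2 ∧
        (P.2 + s * (R.1 - P.1) < R.2 ∨ R ∈ convexHull ℚ T)} := by
      rintro A ⟨hA, hA'⟩ B ⟨hB, hB'⟩ a b ha hb hab
      have e : (a • A + b • B).2 - (P.2 + s * ((a • A + b • B).1 - P.1)) =
          a * (A.2 - (P.2 + s * (A.1 - P.1))) + b * (B.2 - (P.2 + s * (B.1 - P.1))) := by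
        obtain rfl : b = 1 - a := by linarith
        simp only [Prod.snd_add, Prod.smul_snd, smul_eq_mul, Prod.fst_add, Prod.smul_fst]
        ring
      have h1 : 0 ≤ a * (A.2 - (P.2 + s * (A.1 - P.1))) := mul_nonneg ha (by linarith)
      have h2 : 0 ≤ b * (B.2 - (P.2 + s * (B.1 - P.1))) := mul_nonneg hb (by linarith)
      refine ⟨by linarith, ?_⟩
      rcases ha.eq_or_lt with rfl | ha
      · obtain rfl : b = 1 := by linarith
        simpa using hB'
      rcases hb.eq_or_lt with rfl | hb
      · obtain rfl : a = 1 := by linarith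
        simpa using hA'
      rcases hA' with hA' | hA'
      · left
        have : 0 < a * (A.2 - (P.2 + s * (A.1 - P.1))) := mul_pos ha (by linarith)
        linarith
      rcases hB' with hB' | hB'
      · left
        have : 0 < b * (B.2 - (P.2 + s * (B.1 - P.1))) := mul_pos hb (by linarith)
        linarith
      · exact Or.inr (convex_convexHull ℚ T hA' hB' ha.le hb.le hab)
    refine (convexHull_min (fun A hA ↦ ?_) hconv hR).2
    have hA' := key A (subset_convexHull ℚ _ hA)
    refine ⟨hA', hA'.lt_or_eq.imp id fun h ↦ subset_convexHull ℚ _ ⟨hA, h.symm⟩⟩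
  have hPT : P ∈ convexHull ℚ T := (hface P hP).resolve_left (by simp)
  have hQT : Q ∈ convexHull ℚ T := (hface Q hQ).resolve_left (by rw [hs']; simp)
  have hns : ¬ T.Subsingleton := fun hsub ↦ by
    rcases hsub.eq_empty_or_singleton with h0 | ⟨A, h0⟩
    · simp [h0] at hPT
    · rw [h0, convexHull_singleton, Set.mem_singleton_iff] at hPT hQT
      exact hlt.ne (by rw [hPT, hQT])
  rw [Set.not_subsingleton_iff] at hns
  obtain ⟨A, ⟨⟨i, hi, rfl⟩, hA⟩, B, ⟨⟨j, hj, rfl⟩, hB⟩, hAB⟩ := hns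
  simp only at hA hB
  rcases lt_trichotomy i j with hij | rfl | hij
  · exact ⟨i, hi, j, hj, hij, by rw [hA, hB]; ring⟩
  · exact absurd rfl hAB
  · exact ⟨j, hj, i, hi, hij, by rw [hA, hB]; ring⟩

/-- The denominators of the slopes are at most the degree, so only finitely many numbers occur. -/
theorem newtonDenominators_finite {K : Type*} [Field K] (f : K[X]) :
    (newtonDenominators f).Finite := by
  refine (Set.finite_Iic f.natDegree).subset ?_
  rintro _ ⟨v, -, s, hs, rfl⟩
  obtain ⟨i, -, j, hj, hij, h⟩ := hs.exists_points
  have hij' : ((j : ℚ) - i) ≠ 0 := sub_ne_zero.2 (by exact_mod_cast hij.ne')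
  have e : s = Rat.divInt (addOrd v (f.coeff j) - addOrd v (f.coeff i)) ((j : ℤ) - i) := by
    rw [Rat.divInt_eq_div, eq_div_iff (by push_cast; exact hij')]
    push_cast
    exact h.symm
  have hdvd : (s.den : ℤ) ∣ (j : ℤ) - i := by
    rw [e]; exact Rat.den_dvd _ _
  have h1 := Int.le_of_dvd (by omega) hdvd
  have h2 := le_natDegree_of_mem_supp j hj
  simp only [Set.mem_Iic]
  omega

/-- The Newton index: the least common multiple of the denominators of all slopes of the Newton
polygons of `f` at all normalized discrete valuations of `K`. -/
noncomputable def newtonIndex {K : Type*} [Field K] (f : K[X]) : ℕ :=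
  (newtonDenominators_finite f).toFinset.lcm id

open Classical in
/-- The Galois group of `f` over `K`, as a group of permutations of the roots of `f` in a splitting
field, contains all even permutations of the roots. -/
def GalContainsAlternating {K : Type*} [Field K] (f : K[X]) : Prop :=
  haveI : Fact ((f.map (algebraMap K f.SplittingField)).Splits) := ⟨SplittingField.splits f⟩
  alternatingGroup (f.rootSet f.SplittingField) ≤ (Gal.galActionHom f f.SplittingField).range

/-! Let `L` be the splitting field of `f`; the translate `g` splits there too. Extend a valuation
`v` of `K` to `L` with ramification index `e`. A slope `s` of the Newton polygon of `g` at `v`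
forces a root of `g` in `L` whose order, in absolute value, is `e * |s|`. This is an integer, so
`s.den ∣ e`, and `e` divides the order of the Galois group (`IsNewtonSlope.den_dvd`,
`IsNormalizedDiscrete.exists_extension`).

A prime `q` dividing that order gives, by Cauchy, an element of order `q`. As `q > n / 2`, it is a
single `q`-cycle on the roots, with at least three fixed points. Jordan's theorem
(`Equiv.Perm.alternatingGroup_le_of_isCycle_mem`) then yields the alternating group: elements of the
normalizer of the cycle that induce two transpositions on the fixed points have a commutator which
is, up to a power of the cycle, a 3-cycle. -/

/-! ### Permutation groups: Jordan's theorem on cycles of prime length. -/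

section
open Equiv Equiv.Perm MulAction

variable {α : Type*} [Fintype α] [DecidableEq α]

/-- A permutation that commutes with a cycle and fixes everything outside of its support is a power
of the cycle. -/
theorem Equiv.Perm.IsCycle.mem_zpowers_of_commute {g z : Perm α} (hg : g.IsCycle)
    (hz : Commute z g) (hfix : ∀ x ∉ g.support, z x = x) : z ∈ Subgroup.zpowers g := by
  obtain ⟨hc, h⟩ := hg.commute_iff.1 hz
  rwa [Equiv.Perm.ofSubtype_subtypePerm] at h
  intro x hx
  by_contra hx'
  exact hx (hfix x hx')

/-- A transitive permutation group that contains a cycle of prime length larger than half of the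
degree is primitive, and so is the action on the support of the cycle of the pointwise stabilizer of
its complement. -/
theorem Equiv.Perm.isPreprimitive_of_isCycle_mem_of_card_lt {G : Subgroup (Perm α)}
    [IsPretransitive G α] {g : Perm α} (hc : g.IsCycle) (hg : g ∈ G)
    (hp : (g.support.card).Prime) (hlt : Fintype.card α < 2 * g.support.card) :
    IsPreprimitive (fixingSubgroup G (g.support : Set α)ᶜ)
      (SubMulAction.ofFixingSubgroup G (g.support : Set α)ᶜ) ∧ IsPreprimitive G α := by
  have h1 := isPretransitive_of_isCycle_mem hc hg
  have hcar : ((SubMulAction.ofFixingSubgroup G (g.support : Set α)ᶜ : Set α)) =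
      (g.support : Set α) := by
    ext x
    simp [SubMulAction.mem_ofFixingSubgroup_iff]
  have hcard : Nat.card (SubMulAction.ofFixingSubgroup G (g.support : Set α)ᶜ)
      = g.support.card := by
    rw [← Set.ncard_coe_finset, ← Nat.card_coe_set_eq]
    exact Nat.card_congr (Equiv.setCongr hcar)
  have h2 : IsPreprimitive (fixingSubgroup G (g.support : Set α)ᶜ)
      (SubMulAction.ofFixingSubgroup G (g.support : Set α)ᶜ) :=
    IsPreprimitive.of_prime_card (by rwa [hcard])
  refine ⟨h2, ?_⟩
  let f : SubMulAction.ofFixingSubgroup G (g.support : Set α)ᶜ →ₑ[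
      (fixingSubgroup G (g.support : Set α)ᶜ).subtype] α := ⟨Subtype.val, fun _ _ ↦ rfl⟩
  -- Primitivity passes from the support to `α` because the support has more than half of the
  -- points.
  refine IsPreprimitive.of_card_lt (f := f) ?_
  have : Set.range f = (g.support : Set α) := by
    exact Subtype.range_coe.trans hcar
  rw [this, Set.ncard_coe_finset, Nat.card_eq_fintype_card]
  exact hlt

/-- If `G` is highly transitive, every permutation is realised on a given small set. -/
theorem Equiv.Perm.exists_mem_eqOn_of_isMultiplyPretransitive {α : Type*} [Finite α]
    {G : Subgroup (Perm α)}
    (s : Set α) (h : IsMultiplyPretransitive G α s.ncard) (x : Perm α) :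
    ∃ y ∈ G, ∀ a ∈ s, y a = x a := by
  have e : Fin s.ncard ≃ s := (Finite.equivFin s).symm
  let u : Fin s.ncard ↪ α := e.toEmbedding.trans (Function.Embedding.subtype _)
  obtain ⟨y, hy⟩ := (isMultiplyPretransitive_iff.1 h) u (u.trans x.toEmbedding)
  refine ⟨y, y.2, fun a ha ↦ ?_⟩
  have := DFunLike.congr_fun hy (e.symm ⟨a, ha⟩)
  simpa [u, Subgroup.smul_def] using this

/-- Let `g ∈ G` be a cycle of prime length larger than half of the degree. An element of `G` that
permutes the fixed points of `g` agrees on these with an element of `G` that normalizes the group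
generated by `g` (a Frattini argument). -/
theorem Equiv.Perm.exists_mem_normalizer_eqOn {G : Subgroup (Perm α)} {g y : Perm α}
    (hc : g.IsCycle) (hg : g ∈ G) (hp : (g.support.card).Prime) (hy : y ∈ G)
    (hlt : Fintype.card α < 2 * g.support.card) (hyF : ∀ a ∉ g.support, y a ∉ g.support) :
    ∃ z ∈ G, (∀ a ∉ g.support, z a = y a) ∧ z * g * z⁻¹ ∈ Subgroup.zpowers g := by
  set p := g.support.card with hpdef
  have : Fact p.Prime := ⟨hp⟩
  let H : Subgroup (Perm α) := G ⊓ fixingSubgroup (Perm α) ((g.support : Set α)ᶜ)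
  have memH : ∀ z, z ∈ H ↔ z ∈ G ∧ ∀ a ∉ g.support, z a = a := by
    intro z
    simp only [H, Subgroup.mem_inf, mem_fixingSubgroup_iff, Set.mem_compl_iff, SetLike.mem_coe,
      Perm.smul_def]
  have hgH : g ∈ H := (memH g).2 ⟨hg, fun a ha ↦ by simpa using ha⟩
  have hyinv : ∀ a ∉ g.support, y⁻¹ a ∉ g.support := by
    have hm : Set.MapsTo y ((g.support : Set α)ᶜ) ((g.support : Set α)ᶜ) := fun a ha ↦ hyF a ha
    have hs : Set.SurjOn y ((g.support : Set α)ᶜ) ((g.support : Set α)ᶜ) :=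
      ((Set.toFinite _).injOn_iff_bijOn_of_mapsTo hm).1 y.injective.injOn |>.surjOn
    intro a ha
    obtain ⟨b, hb, rfl⟩ := hs (show a ∈ ((g.support : Set α)ᶜ) from ha)
    simpa using hb
  have hgH' : y * g * y⁻¹ ∈ H := by
    refine (memH _).2 ⟨G.mul_mem (G.mul_mem hy hg) (G.inv_mem hy), fun a ha ↦ ?_⟩
    have := hyinv a ha
    rw [Perm.notMem_support] at this
    rw [Perm.mul_apply, Perm.mul_apply, this, ← Perm.mul_apply, mul_inv_cancel, Perm.one_apply]
  -- `p ^ 2` does not divide `n!`, since `p ≤ n < 2 * p`. So subgroups of order `p` are Sylow in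
  -- `H`.
  have hfac : (Nat.card H).factorization p = 1 := by
    refine le_antisymm ?_ ?_
    · by_contra! h
      have h2 : p ^ 2 ∣ (Fintype.card α).factorial := by
        refine ((hp.pow_dvd_iff_le_factorization Nat.card_pos.ne').2 h).trans ?_
        rw [← Fintype.card_perm, ← Nat.card_eq_fintype_card]
        exact Subgroup.card_subgroup_dvd_card H
      have h3 : p ≤ Fintype.card α := Finset.card_le_univ _
      obtain ⟨m, hm⟩ := Nat.exists_eq_add_of_le h3
      have h4 := padicValNat_factorial_mul_add (p := p) (n := m) 1 (by omega)
      rw [mul_one, ← hm] at h4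
      have h5 := padicValNat_factorial_mul (p := p) 1
      rw [mul_one, Nat.factorial_one, padicValNat_one_right] at h5
      have h6 := (padicValNat_dvd_iff_le (Nat.factorial_ne_zero _)).1 h2
      omega
    · rw [← hp.dvd_iff_one_le_factorization Nat.card_pos.ne', hpdef, ← hc.orderOf,
        ← Subgroup.orderOf_mk g hgH]
      exact orderOf_dvd_natCard _
  have key : ∀ k : H, orderOf k = p → Nat.card (Subgroup.zpowers k) =
      p ^ (Nat.card H).factorization p := by
    intro k hk
    rw [hfac, pow_one, Nat.card_zpowers, hk]
  have ho : orderOf (⟨g, hgH⟩ : H) = p := by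
    rw [Subgroup.orderOf_mk, hc.orderOf]
  have ho' : orderOf (⟨y * g * y⁻¹, hgH'⟩ : H) = p := by
    rw [Subgroup.orderOf_mk, ← MulAut.conj_apply, MulEquiv.orderOf_eq, hc.orderOf]
  -- Sylow conjugacy inside `H`: the corrector `k` fixes every point off the support, so `k * y`
  -- still agrees with `y` there.
  obtain ⟨k, hk⟩ := exists_smul_eq H (Sylow.ofCard _ (key _ ho')) (Sylow.ofCard _ (key _ ho))
  refine ⟨k * y, G.mul_mem ((memH _).1 k.2).1 hy, fun a ha ↦ ?_, ?_⟩
  · rw [Perm.mul_apply, ((memH _).1 k.2).2 _ (hyF a ha)]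
  · have : k * (⟨y * g * y⁻¹, hgH'⟩ : H) * k⁻¹ ∈ (Sylow.ofCard _ (key _ ho) : Sylow p H) := by
      rw [← hk]
      exact Subgroup.smul_mem_pointwise_smul _ (MulAut.conj k) _ (Subgroup.mem_zpowers _)
    obtain ⟨n, hn⟩ := Subgroup.mem_zpowers_iff.1 (show _ ∈ Subgroup.zpowers (⟨g, hgH⟩ : H) from this)
    refine Subgroup.mem_zpowers_iff.2 ⟨n, ?_⟩
    simpa [mul_assoc] using congrArg Subtype.val hn

/-- If `x` and `y` normalize the cyclic group generated by `g`, their commutator centralizes it. -/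
theorem commute_commutator_of_conj_mem_zpowers {G : Type*} [Group G] {g x y : G}
    (hx : x * g * x⁻¹ ∈ Subgroup.zpowers g) (hy : y * g * y⁻¹ ∈ Subgroup.zpowers g) :
    Commute (x⁻¹ * y⁻¹ * x * y) g := by
  obtain ⟨i, hi⟩ := Subgroup.mem_zpowers_iff.1 hx
  obtain ⟨j, hj⟩ := Subgroup.mem_zpowers_iff.1 hy
  -- Conjugation by `x` and by `y` raises to the powers `i` and `j` on the group generated by `g`,
  -- and these maps commute.
  have h : (x * y) * g * (x * y)⁻¹ = (y * x) * g * (y * x)⁻¹ := by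
    have h1 : (x * y) * g * (x * y)⁻¹ = x * (y * g * y⁻¹) * x⁻¹ := by group
    have h2 : (y * x) * g * (y * x)⁻¹ = y * (x * g * x⁻¹) * y⁻¹ := by group
    rw [h1, h2, ← hi, ← hj, ← conj_zpow, ← conj_zpow, ← hi, ← hj, ← zpow_mul, ← zpow_mul, mul_comm]
  have h3 : x⁻¹ * y⁻¹ * x * y * g = (y * x)⁻¹ * ((x * y) * g * (x * y)⁻¹) * (x * y) := by group
  rw [Commute, SemiconjBy, h3, h]
  group

/-- **Jordan's theorem** on primitive groups with a cycle of prime length, in the range where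
primitivity is automatic. -/
theorem Equiv.Perm.alternatingGroup_le_of_isCycle_mem {G : Subgroup (Perm α)}
    [IsPretransitive G α] {g : Perm α} (hc : g.IsCycle) (hg : g ∈ G)
    (hp : (g.support.card).Prime) (hlt : Fintype.card α < 2 * g.support.card)
    (h3 : g.support.card + 3 ≤ Fintype.card α) : alternatingGroup α ≤ G := by
  obtain ⟨hF, hG⟩ := isPreprimitive_of_isCycle_mem_of_card_lt hc hg hp hlt
  have hFc : ((g.support : Set α)ᶜ).ncard = Fintype.card α - g.support.card := by
    rw [Set.ncard_compl, Set.ncard_coe_finset, Nat.card_eq_fintype_card]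
  obtain ⟨m, hm⟩ : ∃ m, ((g.support : Set α)ᶜ).ncard = m + 1 :=
    ⟨_, (Nat.sub_add_cancel (by omega : 1 ≤ ((g.support : Set α)ᶜ).ncard)).symm⟩
  have hp2 := hp.two_le
  -- The pointwise stabilizer of the `m + 1` fixed points is primitive on the other points, which
  -- makes `G` multiply primitive of order `m + 2`.
  have hmp : IsMultiplyPreprimitive G α (m + 2) :=
    hG.isMultiplyPreprimitive hm (by rw [Nat.card_eq_fintype_card]; omega) hF
  have hmt : IsMultiplyPretransitive G α ((g.support : Set α)ᶜ).ncard := by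
    have := hmp.isMultiplyPretransitive
    refine isMultiplyPretransitive_of_le (n := m + 2) (by omega) ?_
    rw [Nat.card_eq_fintype_card]
    omega
  obtain ⟨a, b, c, ha, hb, hcc, hab, hac, hbc⟩ :
      ∃ a b c, a ∉ g.support ∧ b ∉ g.support ∧ c ∉ g.support ∧ a ≠ b ∧ a ≠ c ∧ b ≠ c := by
    have : 2 < (g.supportᶜ).card := by rw [Finset.card_compl]; omega
    obtain ⟨a, b, c, h⟩ := Finset.two_lt_card_iff.1 this
    exact ⟨a, b, c, by simpa only [Finset.mem_compl] using h⟩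
  have real : ∀ x : Perm α, (∀ u ∉ g.support, x u ∉ g.support) →
      ∃ z ∈ G, (∀ u ∉ g.support, z u = x u) ∧ z * g * z⁻¹ ∈ Subgroup.zpowers g := by
    intro x hx
    obtain ⟨y, hy, hyx⟩ := exists_mem_eqOn_of_isMultiplyPretransitive _ hmt x
    have hyx' : ∀ u ∉ g.support, y u = x u := fun u hu ↦ hyx u (by simpa using hu)
    obtain ⟨z, hz, h1, h2⟩ := exists_mem_normalizer_eqOn hc hg hp hy hlt
      (fun u hu ↦ by rw [hyx' u hu]; exact hx u hu)
    exact ⟨z, hz, fun u hu ↦ (h1 u hu).trans (hyx' u hu), h2⟩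
  have hsw : ∀ r s, r ∉ g.support → s ∉ g.support → ∀ u ∉ g.support,
      swap r s u ∉ g.support := by
    intro r s hr hs u hu
    rw [swap_apply_def]
    split_ifs <;> assumption
  obtain ⟨x, hxG, hxe, hxn⟩ := real (swap a b) (hsw a b ha hb)
  obtain ⟨y, hyG, hye, hyn⟩ := real (swap a c) (hsw a c ha hcc)
  -- This is the commutator of the two transpositions, and also the square of a 3-cycle.
  set t : Perm α := (swap a b * swap a c) * (swap a b * swap a c) with ht
  have ht3 : t.IsThreeCycle := (isThreeCycle_swap_mul_swap_same hab hac hbc).isThreeCycle_sq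
  refine alternatingGroup_le_of_isPreprimitive_of_isThreeCycle_mem hG ht3 ?_
  -- the commutator of `x` and `y` centralises `g` and agrees with `t` off the support of `g`
  have hcomm : Commute (x⁻¹ * y⁻¹ * x * y) g :=
    commute_commutator_of_conj_mem_zpowers hxn hyn
  have htg : Commute t g := by
    have hd : ∀ r s, r ∉ g.support → s ∉ g.support → Commute (swap r s) g := by
      intro r s hr hs
      refine Disjoint.commute fun u ↦ ?_
      by_cases hu : u ∈ g.support
      · left
        exact swap_apply_of_ne_of_ne (fun h ↦ hr (h ▸ hu)) (fun h ↦ hs (h ▸ hu))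
      · right; simpa using hu
    have := (hd a b ha hb).mul_left (hd a c ha hcc)
    exact this.mul_left this
  have hxi : ∀ u ∉ g.support, x⁻¹ u = swap a b u := by
    intro u hu
    rw [Perm.inv_eq_iff_eq, hxe _ (hsw a b ha hb u hu), swap_apply_self]
  have hyi : ∀ u ∉ g.support, y⁻¹ u = swap a c u := by
    intro u hu
    rw [Perm.inv_eq_iff_eq, hye _ (hsw a c ha hcc u hu), swap_apply_self]
  -- The quotient commutes with `g` and is trivial off its support, hence is a power of `g`. This
  -- puts `t` in `G`.
  have hmem : x⁻¹ * y⁻¹ * x * y * t⁻¹ ∈ Subgroup.zpowers g := by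
    refine hc.mem_zpowers_of_commute (hcomm.mul_left htg.inv_left) fun u hu ↦ ?_
    have h1 := hsw a b ha hb
    have h2 := hsw a c ha hcc
    simp only [ht, mul_inv_rev, swap_inv, Perm.mul_apply]
    rw [hye _ (h2 _ (h1 _ (h2 _ (h1 _ hu)))), swap_apply_self,
      hxe _ (h1 _ (h2 _ (h1 _ hu))), swap_apply_self,
      hyi _ (h2 _ (h1 _ hu)), swap_apply_self, hxi _ (h1 _ hu), swap_apply_self]
  have hmemG := (Subgroup.zpowers_le.2 hg) hmem
  have hxy : x⁻¹ * y⁻¹ * x * y ∈ G :=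
    G.mul_mem (G.mul_mem (G.mul_mem (G.inv_mem hxG) (G.inv_mem hyG)) hxG) hyG
  simpa using (G.mul_mem_cancel_left hxy).1 hmemG
end

/-! ### Discrete valuations and their extension to Galois extensions. -/

section
variable {K : Type*} [Field K]

/-- Value groups in `ℤᵐ⁰` are cyclic, so only nontriviality has to be checked. -/
theorem IsNormalizedDiscrete.isDiscreteValuationRing {v : Valuation K ℤᵐ⁰}
    (hv : IsNormalizedDiscrete v) : IsDiscreteValuationRing v.valuationSubring := by
  have : Nontrivial (MonoidWithZeroHom.valueGroup (MonoidWithZeroHom.ofClass v)) := by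
    obtain ⟨x, hx⟩ := hv (exp 1)
    refine (Subgroup.nontrivial_iff_exists_ne_one _).2 ⟨Units.mk0 (v x) (by rw [hx]; simp), ?_, ?_⟩
    · exact MonoidWithZeroHom.mem_valueGroup _ ⟨x, rfl⟩
    · intro h
      have := congrArg Units.val h
      rw [Units.val_mk0, hx] at this
      simp at this
  infer_instance

open IsDedekindDomain in
/-- A normalized discrete valuation is the valuation of the maximal ideal of its valuation ring. -/
theorem IsNormalizedDiscrete.valuation_maximalIdeal {v : Valuation K ℤᵐ⁰}
    (hv : IsNormalizedDiscrete v) [IsDiscreteValuationRing v.valuationSubring] (x : K) :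
    (IsDiscreteValuationRing.maximalIdeal v.valuationSubring).valuation K x = v x := by
  set P := IsDiscreteValuationRing.maximalIdeal v.valuationSubring with hP
  have hmax : ∀ a : v.valuationSubring,
      a ∈ IsLocalRing.maximalIdeal v.valuationSubring ↔ v (a : K) < 1 := fun a ↦ by
    rw [ValuationSubring.valuation_lt_one_iff]
    exact (Valuation.isEquiv_valuation_valuationSubring v).lt_one_iff_lt_one.symm
  have hunit : ∀ u : K, v u = 1 → P.valuation K u = 1 := by
    intro u hu
    refine (P.valuation_of_algebraMap (K := K) (⟨u, hu.le⟩ : v.valuationSubring)).trans ?_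
    rw [HeightOneSpectrum.intValuation_eq_one_iff]
    exact fun h ↦ ((hmax _).1 h).ne hu
  obtain ⟨π, hπ⟩ := hv (exp (-1))
  have hπ0 : π ≠ 0 := by
    rintro rfl
    rw [map_zero] at hπ
    exact exp_ne_zero hπ.symm
  have hπ1 : v π ≤ 1 := by
    rw [hπ, ← exp_zero]
    exact exp_le_exp.2 (by norm_num)
  have hPπ : P.valuation K π = exp (-1) := by
    refine (P.valuation_of_algebraMap (K := K) (⟨π, hπ1⟩ : v.valuationSubring)).trans ?_
    refine P.intValuation_singleton (fun h0 ↦ hπ0 (congrArg Subtype.val h0)) ?_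
    ext a
    rw [Ideal.mem_span_singleton]
    refine (hmax a).trans ⟨fun h ↦ ?_, ?_⟩
    · have hle : v (a / π) ≤ 1 := by
        rw [map_div₀, hπ]
        rcases eq_or_ne (v (a : K)) 0 with h0 | h0
        · simp [h0]
        · rw [← exp_log h0, ← exp_zero, exp_lt_exp] at h
          rw [← exp_log h0, ← exp_sub, ← exp_zero, exp_le_exp]
          omega
      refine ⟨⟨a / π, hle⟩, Subtype.ext ?_⟩
      exact (mul_div_cancel₀ _ hπ0).symm
    · rintro ⟨c, rfl⟩
      have hc : v (c : K) ≤ 1 := c.2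
      change v (π * c) < 1
      rw [map_mul, hπ]
      refine (mul_le_of_le_one_right' hc).trans_lt ?_
      rw [← exp_zero, exp_lt_exp]
      norm_num
  rcases eq_or_ne x 0 with rfl | hx
  · simp
  have hvx : v x ≠ 0 := by simpa using hx
  -- As `v π = exp (-1)`, this power of the uniformizer cancels the value of `x`; the two valuations
  -- agree on units and on `π`.
  have h1 : v (x * π ^ (log (v x))) = 1 := by
    rw [map_mul, map_zpow₀, hπ, ← exp_zsmul]
    nth_rewrite 1 [← exp_log hvx]
    rw [← exp_add]
    simp
  have h2 := hunit _ h1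
  rw [map_mul, map_zpow₀, hPπ] at h2
  rw [map_mul, map_zpow₀, hπ] at h1
  exact mul_right_cancel₀ (by simp) (h2.trans h1.symm)

open IsDedekindDomain in
/-- A normalized discrete valuation of `K` extends to a finite Galois extension `L`, up to a
ramification index that divides the order of the Galois group. -/
theorem IsNormalizedDiscrete.exists_extension {v : Valuation K ℤᵐ⁰} (hv : IsNormalizedDiscrete v)
    (L : Type*) [Field L] [Algebra K L] [FiniteDimensional K L] [IsGalois K L] :
    ∃ (w : Valuation L ℤᵐ⁰) (e : ℕ), e ∣ Nat.card Gal(L/K) ∧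
      ∀ x, w (algebraMap K L x) = v x ^ e := by
  have := hv.isDiscreteValuationRing
  let A := v.valuationSubring
  let B := integralClosure A L
  have : IsDedekindDomain B := integralClosure.isDedekindDomain A K L
  have : Module.Finite A B := IsIntegralClosure.finite A K L B
  have : IsFractionRing B L := integralClosure.isFractionRing_of_finite_extension K L
  let p := IsDiscreteValuationRing.maximalIdeal A
  have : IsGaloisGroup Gal(L/K) A B := IsGaloisGroup.of_isFractionRing _ A B K L
  obtain ⟨⟨Q, hQ, hQp⟩⟩ := (inferInstance : Nonempty (p.asIdeal.primesOver B))
  let P : HeightOneSpectrum B := ⟨Q, hQ, Ideal.ne_bot_of_liesOver_of_ne_bot p.ne_bot Q⟩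
  have : P.asIdeal.LiesOver p.asIdeal := hQp
  refine ⟨P.valuation L, p.asIdeal.ramificationIdx' P.asIdeal, ?_, fun x ↦ ?_⟩
  -- In a Galois extension the group order is the product of the number of primes above `p`, the
  -- ramification index and the residue degree.
  · rw [Ideal.ramificationIdx'_eq_ramificationIdx _ _ p.ne_bot,
      ← Ideal.ramificationIdxIn_eq_ramificationIdx p.asIdeal P.asIdeal Gal(L/K),
      ← Ideal.ncard_primesOver_mul_ramificationIdxIn_mul_inertiaDegIn p.asIdeal B Gal(L/K)]
    exact (Dvd.intro _ rfl).mul_left _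
  · rw [← HeightOneSpectrum.valuation_liesOver L p P, hv.valuation_maximalIdeal]

/-! ### Dominant terms and the values of roots. -/

/-- The property that, for the weights `V aᵢ * ρ ^ i`, the polynomial `∑ aᵢ xⁱ` has a single
dominant term. -/
def HasDominantTerm {Γ : Type*} [LinearOrderedCommGroupWithZero Γ] (V : Valuation K Γ) (ρ : Γ)
    (h : K[X]) : Prop :=
  ∃ i, ∀ j, j ≠ i → V (h.coeff j) * ρ ^ j < V (h.coeff i) * ρ ^ i

variable {Γ : Type*} [LinearOrderedCommGroupWithZero Γ] {V : Valuation K Γ} {ρ : Γ}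

theorem HasDominantTerm.C (ρ : Γ) {c : K} (hc : c ≠ 0) : HasDominantTerm V ρ (C c) := by
  refine ⟨0, fun j hj ↦ ?_⟩
  simp [coeff_C, hj, zero_lt_iff, hc]

theorem HasDominantTerm.X_sub_C {a : K} (h0 : ρ ≠ 0) (h : V a ≠ ρ) :
    HasDominantTerm V ρ (X - Polynomial.C a) := by
  rcases lt_or_gt_of_ne h with h | h
  · refine ⟨1, fun j hj ↦ ?_⟩
    rcases j with _ | _ | j
    · simpa using h
    · exact absurd rfl hj
    · simpa [coeff_X, coeff_C, zero_lt_iff] using h0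
  · refine ⟨0, fun j hj ↦ ?_⟩
    rcases j with _ | _ | j
    · exact absurd rfl hj
    · simpa using h
    · simpa [coeff_X, coeff_C, zero_lt_iff] using ne_zero_of_lt h

/-- As in Gauss's lemma: the product of the dominant terms strictly outweighs every other product of
two terms, and by the ultrametric inequality no sum of those can match it. -/
theorem HasDominantTerm.mul {f g : K[X]} (hf : HasDominantTerm V ρ f) (hg : HasDominantTerm V ρ g) :
    HasDominantTerm V ρ (f * g) := by
  obtain ⟨i, hi⟩ := hf
  obtain ⟨j, hj⟩ := hg
  have e : ∀ x : ℕ × ℕ, V (f.coeff x.1 * g.coeff x.2) * ρ ^ (x.1 + x.2) =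
      (V (f.coeff x.1) * ρ ^ x.1) * (V (g.coeff x.2) * ρ ^ x.2) := by
    intro x
    rw [map_mul, pow_add]
    ac_rfl
  have hi0 := zero_le.trans_lt (hi (i + 1) (by omega))
  have hj0 := zero_le.trans_lt (hj (j + 1) (by omega))
  have hlt : ∀ x : ℕ × ℕ, x ≠ (i, j) → V (f.coeff x.1 * g.coeff x.2) * ρ ^ (x.1 + x.2) <
      V (f.coeff i * g.coeff j) * ρ ^ (i + j) := by
    rintro ⟨k, l⟩ hx
    rw [e, e (i, j)]
    rcases eq_or_ne k i with rfl | hk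
    · have hl : l ≠ j := fun h ↦ hx (by rw [h])
      exact mul_lt_mul_of_pos_left (hj l hl) hi0
    · rcases eq_or_ne l j with rfl | hl
      · exact mul_lt_mul_of_pos_right (hi k hk) hj0
      · exact mul_lt_mul'' (hi k hk) (hj l hl) zero_le zero_le
  have hpos : 0 < V (f.coeff i * g.coeff j) * ρ ^ (i + j) := by
    rw [e (i, j)]; exact mul_pos hi0 hj0
  -- the weight of a sum of light terms is light
  have hsum : ∀ (n : ℕ) (s : Finset (ℕ × ℕ)), (∀ x ∈ s, x.1 + x.2 = n ∧ x ≠ (i, j)) →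
      V (∑ x ∈ s, f.coeff x.1 * g.coeff x.2) * ρ ^ n < V (f.coeff i * g.coeff j) * ρ ^ (i + j) := by
    intro n s
    induction s using Finset.induction_on with
    | empty => simpa using hpos
    | insert a s ha ih =>
      intro hs
      rw [Finset.sum_insert ha]
      have h1 := hlt a (hs a (Finset.mem_insert_self _ _)).2
      rw [(hs a (Finset.mem_insert_self _ _)).1] at h1
      have h2 := ih fun x hx ↦ hs x (Finset.mem_insert_of_mem hx)
      refine (mul_le_mul_left (V.map_add _ _) (ρ ^ n)).trans_lt ?_
      rcases max_choice (V (f.coeff a.1 * g.coeff a.2)) (V (∑ x ∈ s, f.coeff x.1 * g.coeff x.2))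
        with h | h <;> rw [h] <;> assumption
  have hmain : V ((f * g).coeff (i + j)) * ρ ^ (i + j) =
      V (f.coeff i * g.coeff j) * ρ ^ (i + j) := by
    have hmem : (i, j) ∈ Finset.HasAntidiagonal.antidiagonal (i + j) := by simp
    rw [coeff_mul, ← Finset.add_sum_erase _ _ hmem]
    have h1 := hsum (i + j) ((Finset.HasAntidiagonal.antidiagonal (i + j)).erase (i, j)) (fun x hx ↦ by
      rw [Finset.mem_erase, Finset.HasAntidiagonal.mem_antidiagonal] at hx
      exact ⟨hx.2, hx.1⟩)
    rw [V.map_add_eq_of_lt_left]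
    exact lt_of_mul_lt_mul_right h1 zero_le
  refine ⟨i + j, fun n hn ↦ ?_⟩
  rw [hmain, coeff_mul]
  refine hsum n _ fun x hx ↦ ⟨Finset.HasAntidiagonal.mem_antidiagonal.1 hx, ?_⟩
  rintro rfl
  exact hn (Finset.HasAntidiagonal.mem_antidiagonal.1 hx).symm

/-- If two terms of a split polynomial have the same maximal weight, then there is a root of the
corresponding value. -/
theorem Polynomial.Splits.exists_root_valuation_eq {h : K[X]} (hs : h.Splits) (h0 : ρ ≠ 0)
    (hdom : ¬ HasDominantTerm V ρ h) (hne : h ≠ 0) : ∃ a ∈ h.roots, V a = ρ := by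
  by_contra! H
  refine hdom ?_
  rw [hs.eq_prod_roots]
  refine (HasDominantTerm.C ρ (leadingCoeff_ne_zero.2 hne)).mul ?_
  generalize h.roots = s at H
  induction s using Multiset.induction_on with
  | empty => simpa using HasDominantTerm.C (V := V) ρ (one_ne_zero)
  | cons a s ih =>
    rw [Multiset.map_cons, Multiset.prod_cons]
    exact (HasDominantTerm.X_sub_C h0 (H a (Multiset.mem_cons_self _ _))).mul
      (ih fun b hb ↦ H b (Multiset.mem_cons_of_mem hb))

/-! ### Slopes of the Newton polygon and ramification. -/

/-- A slope of the Newton polygon is attained twice: it is not the case that all the points but one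
lie strictly above a line of that slope through the remaining one. -/
theorem IsNewtonSlope.exists_ne_le {v : Valuation K ℤᵐ⁰} {g : K[X]} {s : ℚ}
    (h : IsNewtonSlope v g s) {i : ℕ} (hi : i ∈ g.support) :
    ∃ j ∈ g.support, j ≠ i ∧
      (addOrd v (g.coeff j) : ℚ) - s * j ≤ addOrd v (g.coeff i) - s * i := by
  by_contra! H
  obtain ⟨P, Q, hlt, hPQ, hs⟩ := h
  have hQs : Q.2 = P.2 + s * (Q.1 - P.1) := by
    have : Q.1 - P.1 ≠ 0 := (sub_pos.2 hlt).ne'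
    rw [hs]; field_simp; ring
  set A : ℚ × ℚ := ((i : ℚ), (addOrd v (g.coeff i) : ℚ)) with hA
  have hAm : A ∈ convexHull ℚ (newtonPoints v g) := subset_convexHull ℚ _ ⟨i, hi, rfl⟩
  have hPA := le_of_segment_subset_newtonPolygon hlt hPQ hAm
  rw [← hs] at hPA
  have hull : ∀ R ∈ convexHull ℚ (newtonPoints v g),
      A.2 - s * A.1 < R.2 - s * R.1 ∨ R = A := by
    have hconv : Convex ℚ {R : ℚ × ℚ | A.2 - s * A.1 < R.2 - s * R.1 ∨ R = A} := by
      rintro R hR S hS a b ha hb hab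
      have e : (a • R + b • S).2 - s * (a • R + b • S).1 - (A.2 - s * A.1) =
          a * (R.2 - s * R.1 - (A.2 - s * A.1)) + b * (S.2 - s * S.1 - (A.2 - s * A.1)) := by
        obtain rfl : b = 1 - a := by linarith
        simp only [Prod.snd_add, Prod.smul_snd, smul_eq_mul, Prod.fst_add, Prod.smul_fst]
        ring
      rcases ha.eq_or_lt with rfl | ha
      · obtain rfl : b = 1 := by linarith
        simpa using hS
      rcases hb.eq_or_lt with rfl | hb
      · obtain rfl : a = 1 := by linarith
        simpa using hR
      rcases hR with hR | rfl
      · left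
        have h1 := mul_pos ha (sub_pos.2 hR)
        have h2 : 0 ≤ b * (S.2 - s * S.1 - (A.2 - s * A.1)) := by
          rcases hS with hS | rfl
          · exact (mul_pos hb (sub_pos.2 hS)).le
          · simp
        linarith
      · rcases hS with hS | rfl
        · left
          have h1 := mul_pos hb (sub_pos.2 hS)
          rw [sub_self, mul_zero, zero_add] at e
          linarith
        · right
          rw [← add_smul, hab, one_smul]
    refine fun R hR ↦ convexHull_min ?_ hconv hR
    rintro _ ⟨j, hj, rfl⟩
    rcases eq_or_ne j i with rfl | hji
    · exact Or.inr rfl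
    · exact Or.inl (H j hj hji)
  -- By `hPA`, neither `P` nor `Q` is strictly above the line of slope `s` through `A`, so both
  -- equal `A`.
  have hP := (hull P (hPQ (left_mem_segment ℚ P Q)).1).resolve_left (by linarith)
  have hQ := (hull Q (hPQ (right_mem_segment ℚ P Q)).1).resolve_left (by linarith)
  rw [hP, hQ] at hlt
  exact lt_irrefl _ hlt

/-- If `v` extends to `w` on a field `L` over which `g` splits, with ramification index `e`, then
`e` is a multiple of the denominators of the slopes of the Newton polygon of `g` at `v`. -/
theorem IsNewtonSlope.den_dvd {v : Valuation K ℤᵐ⁰} {g : K[X]} {s : ℚ}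
    (h : IsNewtonSlope v g s) {L : Type*} [Field L] [Algebra K L] (w : Valuation L ℤᵐ⁰) {e : ℕ}
    (he : e ≠ 0) (hw : ∀ x, w (algebraMap K L x) = v x ^ e)
    (hg : (g.map (algebraMap K L)).Splits) : s.den ∣ e := by
  have hd : s.den ≠ 0 := s.den_nz
  -- The wanted root has `log (w a) = e * s`, perhaps not visibly an integer. Raising values to the
  -- power `s.den` clears the denominator, and the target becomes `ρ`.
  let V : Valuation L ℤᵐ⁰ := w.map (powMonoidWithZeroHom hd) fun a b hab ↦ pow_le_pow_left' hab _
  have hV : ∀ x, V x = w x ^ s.den := fun x ↦ rfl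
  let ρ : ℤᵐ⁰ := exp (e * s.num)
  have hcoeff : ∀ k ∈ g.support, V ((g.map (algebraMap K L)).coeff k) * ρ ^ k =
      exp (-(e * (s.den * addOrd v (g.coeff k) - s.num * k))) := by
    intro k hk
    have h0 : v (g.coeff k) ≠ 0 := by simpa using hk
    rw [hV, coeff_map, hw, ← exp_log h0, ← exp_nsmul, ← exp_nsmul, ← exp_nsmul, ← exp_add, addOrd]
    congr 1
    simp only [nsmul_eq_mul]
    ring
  have hdom : ¬ HasDominantTerm V ρ (g.map (algebraMap K L)) := by
    rintro ⟨i, hi⟩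
    have hi0 : i ∈ g.support := by
      by_contra hn
      have := hi (i + 1) (by omega)
      rw [notMem_support_iff] at hn
      simp [hn] at this
    obtain ⟨j, hj, hji, hle⟩ := h.exists_ne_le hi0
    have := hi j hji
    rw [hcoeff i hi0, hcoeff j hj, exp_lt_exp, neg_lt_neg_iff] at this
    have h1 := lt_of_mul_lt_mul_left this (by positivity)
    have h2 : (s.den : ℚ) * addOrd v (g.coeff i) - s.num * i <
        s.den * addOrd v (g.coeff j) - s.num * j := by exact_mod_cast h1
    have hd' : (0 : ℚ) < s.den := by exact_mod_cast s.pos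
    have hs : (s.num : ℚ) = s.den * s := by rw [mul_comm]; exact (Rat.mul_den_eq_num s).symm
    rw [hs] at h2
    have h3 := mul_le_mul_of_nonneg_left hle hd'.le
    linarith
  have hne : g.map (algebraMap K L) ≠ 0 := by
    obtain ⟨i, hi, -⟩ := h.exists_points
    rw [Polynomial.map_ne_zero_iff (algebraMap K L).injective]
    rintro rfl
    simp at hi
  obtain ⟨a, -, ha⟩ := hg.exists_root_valuation_eq exp_ne_zero hdom hne
  have ha0 : w a ≠ 0 := by
    intro h0
    rw [hV, h0, zero_pow hd] at ha
    exact exp_ne_zero ha.symm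
  rw [hV, ← exp_log ha0, ← exp_nsmul, exp_inj, nsmul_eq_mul] at ha
  -- The value of the root reads `s.den * log (w a) = e * s.num`, with `s.num` prime to `s.den`.
  have hdvd : (s.den : ℤ) ∣ e * s.num := ⟨_, ha.symm⟩
  refine Int.natCast_dvd_natCast.1 (IsCoprime.dvd_of_dvd_mul_right ?_ hdvd)
  rw [Int.isCoprime_iff_nat_coprime]
  simpa using s.reduced.symm

/-- If `g` splits in a finite Galois extension `L` of `K`, then the Newton index of `g` divides the
order of the Galois group. -/
theorem newtonIndex_dvd_card {g : K[X]} (L : Type*) [Field L] [Algebra K L]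
    [FiniteDimensional K L] [IsGalois K L] (hg : (g.map (algebraMap K L)).Splits) :
    newtonIndex g ∣ Nat.card Gal(L/K) := by
  refine Finset.lcm_dvd fun d hd ↦ ?_
  obtain ⟨v, hv, s, hs, rfl⟩ := (newtonDenominators_finite g).mem_toFinset.1 hd
  obtain ⟨w, e, he, hw⟩ := hv.exists_extension L
  exact (hs.den_dvd w (ne_zero_of_dvd_ne_zero Nat.card_pos.ne' he) hw hg).trans he
end

/-! ### The Galois group as a permutation group of the roots. -/

/-- The Galois group of a separable irreducible polynomial contains the alternating group if its
order has a prime divisor `q` with `n / 2 < q < n - 2`, for `n` the degree. -/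
theorem galContainsAlternating_of_prime_dvd_card {K : Type*} [Field K] {f : K[X]}
    (hf : Irreducible f) (hsep : f.Separable) {q : ℕ} (hq : q.Prime) (hdvd : q ∣ Nat.card f.Gal)
    (h1 : f.natDegree < 2 * q) (h2 : q + 3 ≤ f.natDegree) : GalContainsAlternating f := by
  have : Fact ((f.map (algebraMap K f.SplittingField)).Splits) := ⟨SplittingField.splits f⟩
  have : Fact q.Prime := ⟨hq⟩
  classical
  have hcard : Fintype.card (f.rootSet f.SplittingField) = f.natDegree :=
    card_rootSet_eq_natDegree hsep (SplittingField.splits f)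
  have := Gal.galAction_isPretransitive f f.SplittingField hf
  have htr : MulAction.IsPretransitive (Gal.galActionHom f f.SplittingField).range
      (f.rootSet f.SplittingField) := by
    refine ⟨fun x y ↦ ?_⟩
    obtain ⟨σ, hσ⟩ := MulAction.exists_smul_eq f.Gal x y
    exact ⟨⟨_, σ, rfl⟩, hσ⟩
  obtain ⟨σ, hσ⟩ := exists_prime_orderOf_dvd_card' q hdvd
  set g := Gal.galActionHom f f.SplittingField σ with hg
  have hgo : orderOf g = q := by
    rw [← hσ, hg, orderOf_injective _ (Gal.galActionHom_injective f f.SplittingField)]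
  -- An element of prime order `q` is a product of disjoint `q`-cycles, and fewer than `2 * q`
  -- points leave room for one only.
  have hc : g.IsCycle :=
    Equiv.Perm.isCycle_of_prime_order' (by rwa [hgo]) (by rw [hgo, hcard]; exact h1)
  have hsc : g.support.card = q := by rw [← hc.orderOf, hgo]
  have key := Equiv.Perm.alternatingGroup_le_of_isCycle_mem
    (G := (Gal.galActionHom f f.SplittingField).range) hc ⟨σ, rfl⟩ (by rwa [hsc])
    (by rw [hcard, hsc]; exact h1) (by rw [hcard, hsc]; exact h2)
  unfold GalContainsAlternating
  convert key

theorem theorem2p2 {K : Type*} [Field K] (hK : IsGlobalField K) (f : K[X]) (hf : Irreducible f)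
    (hsep : f.Separable) (μ : K) (g : K[X]) (hg : g = f.comp (X - C μ)) :
    newtonIndex g ∣ Nat.card f.Gal ∧
      ((∃ q : ℕ, q.Prime ∧ q ∣ newtonIndex g ∧
          (f.natDegree : ℚ) / 2 < q ∧ (q : ℚ) < (f.natDegree : ℚ) - 2) →
        GalContainsAlternating f) := by
  have hgal : IsGalois K f.SplittingField := IsGalois.of_separable_splitting_field hsep
  have hsplit : (g.map (algebraMap K f.SplittingField)).Splits := by
    rw [hg, Polynomial.map_comp]
    refine (SplittingField.splits f).comp_of_natDegree_le_one ?_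
    simp
  have hdvd : newtonIndex g ∣ Nat.card f.Gal := newtonIndex_dvd_card f.SplittingField hsplit
  refine ⟨hdvd, ?_⟩
  rintro ⟨q, hq, hqd, h1, h2⟩
  refine galContainsAlternating_of_prime_dvd_card hf hsep hq (hqd.trans hdvd) ?_ ?_
  · have : (f.natDegree : ℚ) < 2 * q := by linarith
    exact_mod_cast this
  · have : (q : ℚ) + 2 < f.natDegree := by linarith
    have : q + 2 < f.natDegree := by exact_mod_cast this
    omega
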